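/- For a set $A\subset\mathbb R^2$ let $\Gamma_+(A)=\operatorname{conv}(A+\mathbb R^2_{\ge 0})$; the Newton diagram of $A$ is the union of the compact faces of the boundary of $\Gamma_+(A)$. For positive integers $a,b$ let $\mathrm{tr}(a,b)$ denote the segment with end-points $(0,b)$ and $(a,0)$. The Newton number of a diagram $D$ with end-points $(a,0)$ and $(0,b)$ on the axes is $\nu(D)=2A-a-b+1$, where $A$ is the area of the part of the non-negative quadrant below $D$ (that is, of $\mathbb R^2_{\ge0}\setminus\Gamma_+(D)$). A deformation of a diagram $D$ is the Newton diagram of $D\cup P$ for some set $P$ of lattice points of the non-negative quadrant with $(0,0)\notin P$. **Theorem.** Let $p,q$ be integers with $4<p<q$, write $q=kp+r$ with integers $k,r$, $0<r<p$, and put $m=\gcd(p,q)$. Then every integer $n$ with $1\le n\le \nu(\mathrm{tr}(p,q))$ is the Newton number of some deformation of $\mathrm{tr}(p,q)$, except for at most the following numbers: 1. the integers $n$ with $\nu(\mathrm{tr}(p,q))-m<n<\nu(\mathrm{tr}(p,q))$; 2. the integers $n$ with $\nu(\mathrm{tr}(p,kp))-(p-1)<n<\nu(\mathrm{tr}(p,kp))$;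 3. the number $\nu(\mathrm{tr}(p,q))-p$, if $p$ is even and $r=p-1$; 4. the number $\nu(\mathrm{tr}(p,kp))-(2p-1)$, if $p$ is even. -/

import Mathlib

open scoped Pointwise

/-- The closed region above a set `A` of points of the plane: the convex hull of `A + ℝ²₊`. -/
def newtonPolyhedron (A : Set (ℝ × ℝ)) : Set (ℝ × ℝ) :=
  convexHull ℝ (A + Set.Ici (0 : ℝ × ℝ))

/-- The Newton diagram spanned by `A`: the compact part of the boundary of the Newton polyhedron
(the boundary without its two half-lines). The compact edges are exactly those of negative slope,
so this is the set of points of the polyhedron that are minimal for the componentwise order. -/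
def newtonDiagram (A : Set (ℝ × ℝ)) : Set (ℝ × ℝ) :=
  {x | Minimal (fun y => y ∈ newtonPolyhedron A) x}

/-- The diagram `tr(p,q)` with both end-points on the axes: the segment from `(0,q)` to `(p,0)`. -/
def tr (p q : ℕ) : Set (ℝ × ℝ) :=
  segment ℝ ((0 : ℝ), (q : ℝ)) ((p : ℝ), (0 : ℝ))

/-- The points of the plane given by a set of lattice points of the non-negative quadrant. -/
def latticePoints (P : Set (ℕ × ℕ)) : Set (ℝ × ℝ) :=
  (fun z : ℕ × ℕ => ((z.1 : ℝ), (z.2 : ℝ))) '' P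

/-- `D'` is a deformation of the diagram `D`: it is the diagram of the convex hull of `D ∪ P` for
some set `P` of lattice points of the non-negative quadrant. The origin is not allowed in `P`, as
it is not in the support of a germ vanishing at `0` (the hull would be the whole quadrant). -/
def IsDeformation (D D' : Set (ℝ × ℝ)) : Prop :=
  ∃ P : Set (ℕ × ℕ), (0, 0) ∉ P ∧ D' = newtonDiagram (D ∪ latticePoints P)

/-- The distance from the origin to the point where the diagram meets the horizontal axis. -/
noncomputable def xIntercept (D : Set (ℝ × ℝ)) : ℝ :=
  sInf {a : ℝ | (a, (0 : ℝ)) ∈ newtonPolyhedron D}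

/-- The distance from the origin to the point where the diagram meets the vertical axis. -/
noncomputable def yIntercept (D : Set (ℝ × ℝ)) : ℝ :=
  sInf {b : ℝ | ((0 : ℝ), b) ∈ newtonPolyhedron D}

/-- The area of the region of the non-negative quadrant below the diagram. -/
noncomputable def areaBelow (D : Set (ℝ × ℝ)) : ℝ :=
  (MeasureTheory.volume (Set.Ici (0 : ℝ × ℝ) \ newtonPolyhedron D)).toReal

/-- The Newton number (Kouchnirenko) `2A - a - b + 1` of a diagram with both end-points on the
axes; every deformation of such a diagram is again of this kind. -/
noncomputable def newtonNumber (D : Set (ℝ × ℝ)) : ℝ :=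
  2 * areaBelow D - xIntercept D - yIntercept D + 1

/-- The number `n` is attained as the Newton number of a deformation of the diagram `D`. -/
def IsAttained (D : Set (ℝ × ℝ)) (n : ℕ) : Prop :=
  ∃ D', IsDeformation D D' ∧ newtonNumber D' = n

/-!
A diagram below the segment from `(0, q)` to `(p, 0)` is a convex chain of lattice edges `(u, v)`,
each going `u` to the right and `v` down, from a point `(0, b)` to a point `(a, 0)` with `a ≤ p` and
`b ≤ q`. Its Newton number is `(a - 1) (b - 1) - d`, where the deficit `d` is twice the area between
the chain and the segment joining its end-points, that is, the sum of the determinants of all pairs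
of edges (`newtonNumber_eq_of_chain`, `isAttained_of_chain`). The theorem thus becomes a question
about the deficits that occur for given end-points.

Determinants do not change when a constant slope is added to all edges. For `q = k p + r` this turns
a chain for `(p - c, r)` followed by a horizontal edge of length `c` into a chain for `(p, q)`, and
adds `r c` to the deficit (`IsDeficit.shear_append`). A Euclidean induction on this step shows that
every `d` with `gcd(p, q) ≤ d ≤ r (p - r)` is a deficit for `(p, q)` (`isDeficit_of_le`).

The Newton numbers of `tr(p, q)` and `tr(p, q - 1)` differ by `p - 1`. For `2 ≤ r ≤ p - 2` the bound
`r (p - r)` is large enough to reach beyond the gap just below `tr(p, q - 1)`, and for `r = p - 1`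
it misses at most one number. So `q` can be lowered one by one until a multiple of `p` is met, where
the second exception occurs. The gap below the next smaller multiple of `p` is filled by chains with a
single interior vertex (`isChainNumber_sub`); below `tr(p, p)` the same argument continues with
`tr(p - 1, p)` (`isChainNumber_sub_of_succ`), down to `p = 5`. The fourth exception turns out not to
be needed: these numbers are attained by a chain with the interior vertex `(2, k (p - 2) - 2)`
(`isDeficit_three_mul_sub_two`).
-/

/-! ### Chains of lattice edges -/

/-- The horizontal extent of a chain of edges: an edge `(u, v)` goes `u` to the right and `v`
down. -/
def chainWidth (l : List (ℕ × ℕ)) : ℕ := (l.map Prod.fst).sum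

/-- The vertical extent of a chain of edges. -/
def chainHeight (l : List (ℕ × ℕ)) : ℕ := (l.map Prod.snd).sum

/-- Edges `(u, v)` going right and strictly down, in order of decreasing steepness `v / u`;
consecutive parallel edges are allowed. -/
structure IsConvexChain (l : List (ℕ × ℕ)) : Prop where
  pos : ∀ e ∈ l, 0 < e.1 ∧ 0 < e.2
  steep : l.Pairwise fun e f => f.2 * e.1 ≤ e.2 * f.1

/-- The sum of the determinants `v u' - u v'` over all pairs of an edge `(u, v)` and a later edge
`(u', v')`. It is twice the area between the chain and the segment joining its end-points. -/
def deficit : List (ℕ × ℕ) → ℤ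
  | [] => 0
  | e :: l => e.2 * chainWidth l - e.1 * chainHeight l + deficit l

/-- The vertices of the chain that begins on the vertical line at `x` and ends on the horizontal
axis. -/
def chainVertices : List (ℕ × ℕ) → ℕ → Set (ℕ × ℕ)
  | [], x => {(x, 0)}
  | e :: l, x => insert (x, chainHeight (e :: l)) (chainVertices l (x + e.1))

/-- The point `z` lies on or above the horizontal axis and the line through each edge of the
chain that begins on the vertical line at `x` and ends on the horizontal axis. -/
def AboveChain : List (ℕ × ℕ) → ℕ → ℝ × ℝ → Prop
  | [], _, z => 0 ≤ z.2
  | e :: l, x, z =>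
    0 ≤ (e.2 : ℝ) * (z.1 - x) + e.1 * (z.2 - chainHeight (e :: l)) ∧ AboveChain l (x + e.1) z

/-- The points on or above the chain that begins on the vertical axis. -/
def chainRegion (l : List (ℕ × ℕ)) : Set (ℝ × ℝ) := {z | 0 ≤ z.1 ∧ AboveChain l 0 z}

@[simp] lemma chainWidth_nil : chainWidth [] = 0 := rfl
@[simp] lemma chainHeight_nil : chainHeight [] = 0 := rfl
@[simp] lemma chainWidth_cons (e : ℕ × ℕ) (l : List (ℕ × ℕ)) :
    chainWidth (e :: l) = e.1 + chainWidth l := by simp [chainWidth]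
@[simp] lemma chainHeight_cons (e : ℕ × ℕ) (l : List (ℕ × ℕ)) :
    chainHeight (e :: l) = e.2 + chainHeight l := by simp [chainHeight]

lemma IsConvexChain.tail {e : ℕ × ℕ} {l : List (ℕ × ℕ)} (h : IsConvexChain (e :: l)) :
    IsConvexChain l :=
  ⟨fun f hf => h.pos f (List.mem_cons_of_mem _ hf), (List.pairwise_cons.1 h.steep).2⟩

/-- Left of the end of a steeper edge, a point above that edge is above the rest of the chain. -/
lemma aboveChain_of_above_edge {e : ℕ × ℕ} {l : List (ℕ × ℕ)} (h : IsConvexChain (e :: l))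
    {x : ℕ} {z : ℝ × ℝ} (hx : z.1 ≤ x)
    (hz : 0 ≤ (e.2 : ℝ) * (z.1 - x) + e.1 * (z.2 - chainHeight l)) : AboveChain l x z := by
  induction l generalizing e x with
  | nil =>
    have h1 : (0 : ℝ) < e.1 := by exact_mod_cast (h.pos e (by simp)).1
    have h2 : (0 : ℝ) ≤ e.2 := by positivity
    simp only [chainHeight_nil, Nat.cast_zero, sub_zero] at hz
    have h3 : (e.2 : ℝ) * (z.1 - x) ≤ 0 := mul_nonpos_of_nonneg_of_nonpos h2 (by linarith)
    exact nonneg_of_mul_nonneg_right (by linarith : (0 : ℝ) ≤ e.1 * z.2) h1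
  | cons f l ih =>
    have h1 : (0 : ℝ) < e.1 := by exact_mod_cast (h.pos e (by simp)).1
    have hs : (f.2 : ℝ) * e.1 ≤ e.2 * f.1 := by
      exact_mod_cast (List.pairwise_cons.1 h.steep).1 f (by simp)
    have key : 0 ≤ (f.2 : ℝ) * (z.1 - x) + f.1 * (z.2 - chainHeight (f :: l)) := by
      have h5 : (0 : ℝ) ≤ f.1 * (e.2 * (z.1 - x) + e.1 * (z.2 - chainHeight (f :: l))) :=
        mul_nonneg (by positivity) hz
      have h6 : (0 : ℝ) ≤ (e.2 * f.1 - f.2 * e.1) * (x - z.1) :=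
        mul_nonneg (by linarith) (by linarith)
      refine nonneg_of_mul_nonneg_right (a := (e.1 : ℝ)) ?_ h1
      linear_combination h5 + h6
    refine ⟨key, ih h.tail (by push_cast; have : (0 : ℝ) ≤ f.1 := by positivity
                               linarith) ?_⟩
    rw [chainHeight_cons] at key
    push_cast at key ⊢
    linear_combination key

/-- Right of the end of a steeper edge, a point above the rest of the chain is above that edge. -/
lemma above_edge_of_aboveChain {e : ℕ × ℕ} {l : List (ℕ × ℕ)} (h : IsConvexChain (e :: l))
    {x : ℕ} {z : ℝ × ℝ} (hx : x ≤ z.1) (hz : AboveChain l x z) :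
    0 ≤ (e.2 : ℝ) * (z.1 - x) + e.1 * (z.2 - chainHeight l) := by
  cases l with
  | nil =>
    have hz' : 0 ≤ z.2 := hz
    have : 0 ≤ z.1 - x := by linarith
    simp only [chainHeight_nil, Nat.cast_zero, sub_zero]
    positivity
  | cons f l =>
    have h1 : (0 : ℝ) < f.1 := by exact_mod_cast (h.pos f (by simp)).1
    have hs : (f.2 : ℝ) * e.1 ≤ e.2 * f.1 := by
      exact_mod_cast (List.pairwise_cons.1 h.steep).1 f (by simp)
    have h5 : (0 : ℝ) ≤ e.1 * (f.2 * (z.1 - x) + f.1 * (z.2 - chainHeight (f :: l))) :=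
      mul_nonneg (by positivity) hz.1
    have h6 : (0 : ℝ) ≤ (e.2 * f.1 - f.2 * e.1) * (z.1 - x) :=
      mul_nonneg (by linarith) (by linarith)
    refine nonneg_of_mul_nonneg_right (a := (f.1 : ℝ)) ?_ h1
    linear_combination h5 + h6

/-- The line through the first edge, based at the end of that edge instead of its beginning. -/
lemma first_edge_eq (e : ℕ × ℕ) (l : List (ℕ × ℕ)) (x : ℕ) (z : ℝ × ℝ) :
    (e.2 : ℝ) * (z.1 - x) + e.1 * (z.2 - chainHeight (e :: l)) =
      (e.2 : ℝ) * (z.1 - (x + e.1 : ℕ)) + e.1 * (z.2 - chainHeight l) := by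
  rw [chainHeight_cons]; push_cast; ring

lemma aboveChain_cons_iff_left {e : ℕ × ℕ} {l : List (ℕ × ℕ)} (h : IsConvexChain (e :: l))
    {x : ℕ} {z : ℝ × ℝ} (hx : z.1 ≤ (x + e.1 : ℕ)) :
    AboveChain (e :: l) x z ↔
      0 ≤ (e.2 : ℝ) * (z.1 - x) + e.1 * (z.2 - chainHeight (e :: l)) :=
  ⟨fun hz => hz.1, fun hz => ⟨hz, aboveChain_of_above_edge h hx (first_edge_eq e l x z ▸ hz)⟩⟩

lemma aboveChain_cons_iff_right {e : ℕ × ℕ} {l : List (ℕ × ℕ)} (h : IsConvexChain (e :: l))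
    {x : ℕ} {z : ℝ × ℝ} (hx : (x + e.1 : ℕ) ≤ z.1) :
    AboveChain (e :: l) x z ↔ AboveChain l (x + e.1) z :=
  ⟨fun hz => hz.2, fun hz => ⟨first_edge_eq e l x z ▸ above_edge_of_aboveChain h hx hz, hz⟩⟩

lemma AboveChain.mono {l : List (ℕ × ℕ)} {x : ℕ} {z w : ℝ × ℝ} (hz : AboveChain l x z)
    (hzw : z ≤ w) : AboveChain l x w := by
  induction l generalizing x with
  | nil => exact le_trans (show 0 ≤ z.2 from hz) hzw.2
  | cons e l ih =>
    refine ⟨hz.1.trans ?_, ih hz.2⟩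
    have := hzw.1
    have := hzw.2
    gcongr

lemma AboveChain.convexComb {l : List (ℕ × ℕ)} {x : ℕ} {z w : ℝ × ℝ} (hz : AboveChain l x z)
    (hw : AboveChain l x w) {a b : ℝ} (ha : 0 ≤ a) (hb : 0 ≤ b) (hab : a + b = 1) :
    AboveChain l x (a • z + b • w) := by
  induction l generalizing x with
  | nil =>
    have h1 : 0 ≤ z.2 := hz
    have h2 : 0 ≤ w.2 := hw
    change 0 ≤ a * z.2 + b * w.2
    positivity
  | cons e l ih =>
    refine ⟨?_, ih hz.2 hw.2⟩
    have h1 := mul_nonneg ha hz.1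
    have h2 := mul_nonneg hb hw.1
    simp only [Prod.fst_add, Prod.snd_add, Prod.smul_fst, Prod.smul_snd, smul_eq_mul]
    obtain rfl : a = 1 - b := by linarith
    linear_combination h1 + h2

lemma convex_chainRegion (l : List (ℕ × ℕ)) : Convex ℝ (chainRegion l) := by
  intro z hz w hw a b ha hb hab
  have h1 : 0 ≤ z.1 := hz.1
  have h2 : 0 ≤ w.1 := hw.1
  exact ⟨show 0 ≤ a * z.1 + b * w.1 by positivity, hz.2.convexComb hw.2 ha hb hab⟩

lemma chainRegion_add_Ici_subset (l : List (ℕ × ℕ)) :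
    chainRegion l + Set.Ici (0 : ℝ × ℝ) ⊆ chainRegion l := by
  rintro _ ⟨z, hz, w, hw, rfl⟩
  have hw' : (0 : ℝ × ℝ) ≤ w := hw
  have hle : z ≤ z + w := le_add_of_nonneg_right hw'
  exact ⟨hz.1.trans hle.1, hz.2.mono hle⟩

lemma le_fst_of_mem_chainVertices {l : List (ℕ × ℕ)} {x : ℕ} {w : ℕ × ℕ}
    (hw : w ∈ chainVertices l x) : x ≤ w.1 := by
  induction l generalizing x with
  | nil => obtain rfl : w = (x, 0) := hw; exact le_rfl
  | cons e l ih =>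
    rcases hw with rfl | hw
    · exact le_rfl
    · exact (Nat.le_add_right _ _).trans (ih hw)

lemma start_mem_chainVertices (l : List (ℕ × ℕ)) (x : ℕ) :
    (x, chainHeight l) ∈ chainVertices l x := by
  cases l with
  | nil => exact rfl
  | cons e l => exact Set.mem_insert _ _

lemma end_mem_chainVertices (l : List (ℕ × ℕ)) (x : ℕ) :
    (x + chainWidth l, 0) ∈ chainVertices l x := by
  induction l generalizing x with
  | nil => exact rfl
  | cons e l ih =>
    refine Set.mem_insert_of_mem _ ?_
    rw [chainWidth_cons, ← add_assoc]
    exact ih _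

lemma aboveChain_of_mem_chainVertices {l : List (ℕ × ℕ)} (h : IsConvexChain l) {x : ℕ}
    {w : ℕ × ℕ} (hw : w ∈ chainVertices l x) : AboveChain l x ((w.1 : ℝ), (w.2 : ℝ)) := by
  induction l generalizing x with
  | nil => exact Nat.cast_nonneg _
  | cons e l ih =>
    rcases hw with rfl | hw
    · rw [aboveChain_cons_iff_left h (by push_cast; simp)]
      simp
    · rw [aboveChain_cons_iff_right h (Nat.cast_le.2 (le_fst_of_mem_chainVertices hw))]
      exact ih h.tail hw

/-- Every vertex lies on a line of negative slope bounding the region, hence it is minimal. -/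
lemma eq_of_le_chainVertex {l : List (ℕ × ℕ)} (h : IsConvexChain l) (hl : l ≠ []) {x : ℕ}
    {w : ℕ × ℕ} (hw : w ∈ chainVertices l x) {z : ℝ × ℝ} (hz : AboveChain l x z)
    (hzw : z ≤ ((w.1 : ℝ), (w.2 : ℝ))) : z = ((w.1 : ℝ), (w.2 : ℝ)) := by
  induction l generalizing x with
  | nil => exact absurd rfl hl
  | cons e l ih =>
    have h1 : (0 : ℝ) < e.1 := by exact_mod_cast (h.pos e (by simp)).1
    have h2 : (0 : ℝ) < e.2 := by exact_mod_cast (h.pos e (by simp)).2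
    have on_edge : (e.2 : ℝ) * (w.1 - x) + e.1 * (w.2 - chainHeight (e :: l)) = 0 →
        z = ((w.1 : ℝ), (w.2 : ℝ)) := by
      intro h0
      have hz1 := hz.1
      have a1 : z.1 ≤ w.1 := hzw.1
      have a2 : z.2 ≤ w.2 := hzw.2
      have b1 : (e.2 : ℝ) * z.1 ≤ e.2 * w.1 := by gcongr
      have b2 : (e.1 : ℝ) * z.2 ≤ e.1 * w.2 := by gcongr
      have c1 : (e.2 : ℝ) * z.1 = e.2 * w.1 := by linarith
      have c2 : (e.1 : ℝ) * z.2 = e.1 * w.2 := by linarith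
      exact Prod.ext (mul_left_cancel₀ h2.ne' c1) (mul_left_cancel₀ h1.ne' c2)
    rcases hw with rfl | hw
    · exact on_edge (by simp)
    · by_cases hl' : l = []
      · subst hl'
        obtain rfl : w = (x + e.1, 0) := hw
        exact on_edge (by simp; ring)
      · exact ih h.tail hl' hw hz.2

/-! ### The Newton polyhedron of a chain -/

lemma mem_newtonPolyhedron_of_le {B : Set (ℝ × ℝ)} {z w : ℝ × ℝ} (hz : z ∈ newtonPolyhedron B)
    (hzw : z ≤ w) : w ∈ newtonPolyhedron B := by
  have h1 : newtonPolyhedron B + Set.Ici (0 : ℝ × ℝ) ⊆ newtonPolyhedron B := by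
    have h2 : convexHull ℝ (Set.Ici (0 : ℝ × ℝ)) = Set.Ici 0 := (convex_Ici _).convexHull_eq
    calc newtonPolyhedron B + Set.Ici (0 : ℝ × ℝ)
        = convexHull ℝ (B + Set.Ici (0 : ℝ × ℝ) + Set.Ici 0) := by
          rw [convexHull_add (B + _), h2]; rfl
      _ ⊆ newtonPolyhedron B := by
          refine convexHull_mono ?_
          rw [add_assoc]
          refine Set.add_subset_add_left ?_
          rintro _ ⟨a, ha, b, hb, rfl⟩
          exact add_nonneg (Set.mem_Ici.1 ha) (Set.mem_Ici.1 hb)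
  refine h1 ⟨z, hz, w - z, sub_nonneg.2 hzw, by simp⟩

lemma subset_newtonPolyhedron (B : Set (ℝ × ℝ)) : B ⊆ newtonPolyhedron B := fun z hz =>
  subset_convexHull ℝ _ ⟨z, hz, 0, le_refl (0 : ℝ × ℝ), by simp⟩

/-- A point above the chain lies above a point of an edge or to the upper right of the last
vertex. -/
lemma mem_newtonPolyhedron_of_aboveChain {l : List (ℕ × ℕ)} (h : IsConvexChain l) {x : ℕ}
    {B : Set (ℝ × ℝ)} (hB : latticePoints (chainVertices l x) ⊆ B) {z : ℝ × ℝ}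
    (hx : x ≤ z.1) (hz : AboveChain l x z) : z ∈ newtonPolyhedron B := by
  induction l generalizing x with
  | nil =>
    have : ((x : ℝ), (0 : ℝ)) ∈ B := hB ⟨(x, 0), rfl, by simp⟩
    exact mem_newtonPolyhedron_of_le (subset_newtonPolyhedron B this) ⟨hx, hz⟩
  | cons e l ih =>
    have hsub : latticePoints (chainVertices l (x + e.1)) ⊆ B :=
      (Set.image_mono (Set.subset_insert _ _)).trans hB
    rcases le_total ((x + e.1 : ℕ) : ℝ) z.1 with hx1 | hx1
    · exact ih h.tail hsub hx1 hz.2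
    · have h1 : (0 : ℝ) < e.1 := by exact_mod_cast (h.pos e (by simp)).1
      have m1 : ((x : ℝ), (chainHeight (e :: l) : ℝ)) ∈ newtonPolyhedron B :=
        subset_newtonPolyhedron B (hB ⟨_, start_mem_chainVertices (e :: l) x, rfl⟩)
      have m2 : (((x + e.1 : ℕ) : ℝ), (chainHeight l : ℝ)) ∈ newtonPolyhedron B :=
        subset_newtonPolyhedron B (hsub ⟨_, start_mem_chainVertices l (x + e.1), rfl⟩)
      have hz1 := hz.1
      rw [chainHeight_cons] at hz1 m1
      push_cast at hx1 hz1 m1 m2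
      set t : ℝ := (z.1 - x) / e.1 with ht
      have ht' : t * e.1 = z.1 - x := by rw [ht]; field_simp
      have t0 : 0 ≤ t := div_nonneg (by linarith) h1.le
      have t1 : t ≤ 1 := (div_le_one h1).2 (by linarith)
      have m3 := (convex_convexHull ℝ (B + Set.Ici (0 : ℝ × ℝ))) m1 m2
        (sub_nonneg.2 t1) t0 (by ring)
      refine mem_newtonPolyhedron_of_le m3 ⟨?_, ?_⟩
      · simp only [Prod.fst_add, Prod.smul_fst, smul_eq_mul]
        linarith
      · simp only [Prod.snd_add, Prod.smul_snd, smul_eq_mul]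
        refine le_of_mul_le_mul_left ?_ h1
        linear_combination hz1 - e.2 * ht'

/-- A set between the vertices of a convex chain and the region above the chain has that region
as its Newton polyhedron. -/
lemma newtonPolyhedron_eq_chainRegion {l : List (ℕ × ℕ)} (h : IsConvexChain l)
    {B : Set (ℝ × ℝ)} (hB : latticePoints (chainVertices l 0) ⊆ B) (hB' : B ⊆ chainRegion l) :
    newtonPolyhedron B = chainRegion l := by
  apply Set.Subset.antisymm
  · exact convexHull_min ((Set.add_subset_add_right hB').trans (chainRegion_add_Ici_subset l))
      (convex_chainRegion l)
  · intro z hz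
    exact mem_newtonPolyhedron_of_aboveChain h hB (by simpa using hz.1) hz.2

lemma latticePoints_subset_chainRegion {l : List (ℕ × ℕ)} (h : IsConvexChain l) :
    latticePoints (chainVertices l 0) ⊆ chainRegion l := by
  rintro _ ⟨w, hw, rfl⟩
  exact ⟨Nat.cast_nonneg _, aboveChain_of_mem_chainVertices h hw⟩

lemma tr_subset_chainRegion {l : List (ℕ × ℕ)} (h : IsConvexChain l) {p q : ℕ}
    (hp : chainWidth l ≤ p) (hq : chainHeight l ≤ q) : tr p q ⊆ chainRegion l := by
  have hmono : ∀ {z w : ℝ × ℝ}, z ∈ chainRegion l → z ≤ w → w ∈ chainRegion l :=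
    fun hz hzw => ⟨hz.1.trans hzw.1, hz.2.mono hzw⟩
  refine (convex_chainRegion l).segment_subset ?_ ?_
  · refine hmono (latticePoints_subset_chainRegion h ⟨_, start_mem_chainVertices l 0, rfl⟩) ⟨?_, ?_⟩
    · simp
    · simpa using hq
  · refine hmono (latticePoints_subset_chainRegion h ⟨_, end_mem_chainVertices l 0, rfl⟩) ⟨?_, ?_⟩
    · simpa using hp
    · simp

/-- The Newton diagram contains the vertices of the chain, so it has the same polyhedron. -/
lemma newtonPolyhedron_newtonDiagram {l : List (ℕ × ℕ)} (h : IsConvexChain l) (hl : l ≠ [])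
    {B : Set (ℝ × ℝ)} (hB : newtonPolyhedron B = chainRegion l) :
    newtonPolyhedron (newtonDiagram B) = chainRegion l := by
  refine newtonPolyhedron_eq_chainRegion h ?_ fun z hz => hB ▸ hz.1
  rintro _ ⟨w, hw, rfl⟩
  refine ⟨hB ▸ latticePoints_subset_chainRegion h ⟨w, hw, rfl⟩, fun z hz hzw => ?_⟩
  rw [hB] at hz
  exact (eq_of_le_chainVertex h hl hw hz.2 hzw).ge

/-! ### Area and Newton number -/

lemma volume_strip (x u v b : ℝ) (hu : 0 < u) (hv : 0 ≤ v) (hb : 0 ≤ b) :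
    MeasureTheory.volume {z : ℝ × ℝ | (x ≤ z.1 ∧ z.1 < x + u) ∧ 0 ≤ z.2 ∧
      v * (z.1 - x) + u * (z.2 - (v + b)) < 0} = ENNReal.ofReal (u * (v + 2 * b) / 2) := by
  have hmeas : MeasurableSet {z : ℝ × ℝ | (x ≤ z.1 ∧ z.1 < x + u) ∧ 0 ≤ z.2 ∧
      v * (z.1 - x) + u * (z.2 - (v + b)) < 0} := by
    measurability
  rw [MeasureTheory.Measure.volume_eq_prod, MeasureTheory.Measure.prod_apply hmeas]
  have hslice : ∀ s : ℝ, MeasureTheory.volume (Prod.mk s ⁻¹' {z : ℝ × ℝ | (x ≤ z.1 ∧ z.1 < x + u) ∧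
      0 ≤ z.2 ∧ v * (z.1 - x) + u * (z.2 - (v + b)) < 0}) =
      (Set.Ico x (x + u)).indicator (fun s => ENNReal.ofReal (v + b - v / u * (s - x))) s := by
    intro s
    by_cases hs : s ∈ Set.Ico x (x + u)
    · rw [Set.indicator_of_mem hs]
      have : (Prod.mk s ⁻¹' {z : ℝ × ℝ | (x ≤ z.1 ∧ z.1 < x + u) ∧
          0 ≤ z.2 ∧ v * (z.1 - x) + u * (z.2 - (v + b)) < 0}) =
          Set.Ico 0 (v + b - v / u * (s - x)) := by
        ext y
        simp only [Set.mem_preimage, Set.mem_ofPred_eq, Set.mem_Ico]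
        have e1 : v * (s - x) + u * (y - (v + b)) = u * (y - (v + b - v / u * (s - x))) := by
          field_simp; ring
        rw [e1]
        constructor
        · rintro ⟨-, h0, h1⟩
          exact ⟨h0, by nlinarith⟩
        · rintro ⟨h0, h1⟩
          exact ⟨hs, h0, mul_neg_of_pos_of_neg hu (by linarith)⟩
      rw [this, Real.volume_Ico, sub_zero]
    · rw [Set.indicator_of_notMem hs]
      convert MeasureTheory.measure_empty (μ := MeasureTheory.volume)
      ext y
      simp only [Set.mem_preimage, Set.mem_ofPred_eq, Set.mem_empty_iff_false, iff_false]
      exact fun h => hs h.1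
  rw [MeasureTheory.lintegral_congr hslice, MeasureTheory.lintegral_indicator measurableSet_Ico,
    MeasureTheory.setLIntegral_congr MeasureTheory.Ico_ae_eq_Ioc,
    ← MeasureTheory.ofReal_integral_eq_lintegral_ofReal,
    ← intervalIntegral.integral_of_le (by linarith)]
  · congr 1
    have hF : ∀ s ∈ Set.uIcc x (x + u), HasDerivAt
        (fun s => (v + b) * s - v / u * ((s - x) ^ 2 / 2)) (v + b - v / u * (s - x)) s := by
      intro s _
      have h1 := ((hasDerivAt_id s).const_mul (v + b)).sub
        (((((hasDerivAt_id s).sub_const x).pow 2).div_const 2).const_mul (v / u))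
      refine h1.congr_deriv ?_
      simp only [id]
      ring
    rw [intervalIntegral.integral_eq_sub_of_hasDerivAt hF
      (Continuous.intervalIntegrable (by fun_prop) _ _)]
    field_simp
    ring
  · exact (Continuous.integrableOn_Icc (by fun_prop)).mono_set Set.Ioc_subset_Icc_self
  · refine (MeasureTheory.ae_restrict_iff' measurableSet_Ioc).2 (Filter.Eventually.of_forall ?_)
    intro s hs
    have h1 : v / u * (s - x) ≤ v / u * u := by
      have := hs.2
      gcongr
      linarith
    rw [div_mul_cancel₀ v hu.ne'] at h1
    change 0 ≤ v + b - v / u * (s - x)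
    linarith

lemma area_cons (e : ℕ × ℕ) (l : List (ℕ × ℕ)) :
    (chainWidth (e :: l) : ℝ) * chainHeight (e :: l) - deficit (e :: l) =
      e.1 * (e.2 + 2 * chainHeight l) + (chainWidth l * chainHeight l - deficit l) := by
  simp only [chainWidth_cons, chainHeight_cons, deficit]
  push_cast
  ring

lemma area_nonneg (l : List (ℕ × ℕ)) :
    (0 : ℝ) ≤ chainWidth l * chainHeight l - deficit l := by
  induction l with
  | nil => simp [deficit]
  | cons e l ih => rw [area_cons]; positivity

lemma volume_below_chain {l : List (ℕ × ℕ)} (h : IsConvexChain l) (x : ℕ) :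
    MeasureTheory.volume {z : ℝ × ℝ | x ≤ z.1 ∧ 0 ≤ z.2 ∧ ¬ AboveChain l x z} =
      ENNReal.ofReal ((chainWidth l * chainHeight l - deficit l) / 2) := by
  induction l generalizing x with
  | nil =>
    have : {z : ℝ × ℝ | x ≤ z.1 ∧ 0 ≤ z.2 ∧ ¬ AboveChain [] x z} = ∅ := by
      ext z
      simp only [Set.mem_ofPred_eq, Set.mem_empty_iff_false, iff_false]
      exact fun hz => hz.2.2 hz.2.1
    rw [this]
    simp [deficit]
  | cons e l ih =>
    have h1 : (0 : ℝ) < e.1 := by exact_mod_cast (h.pos e (by simp)).1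
    have hsplit : {z : ℝ × ℝ | x ≤ z.1 ∧ 0 ≤ z.2 ∧ ¬ AboveChain (e :: l) x z} =
        {z : ℝ × ℝ | ((x : ℝ) ≤ z.1 ∧ z.1 < x + e.1) ∧ 0 ≤ z.2 ∧
          (e.2 : ℝ) * (z.1 - x) + e.1 * (z.2 - (e.2 + chainHeight l)) < 0} ∪
        {z : ℝ × ℝ | (x + e.1 : ℕ) ≤ z.1 ∧ 0 ≤ z.2 ∧ ¬ AboveChain l (x + e.1) z} := by
      ext z
      simp only [Set.mem_ofPred_eq, Set.mem_union]
      rcases lt_or_ge z.1 ((x + e.1 : ℕ) : ℝ) with hx | hx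
      · rw [aboveChain_cons_iff_left h hx.le, chainHeight_cons, not_le]
        push_cast at hx ⊢
        simp only [hx, not_le.2 hx, and_true, false_and, or_false]
      · rw [aboveChain_cons_iff_right h hx]
        have hx' := hx
        push_cast at hx'
        have hx2 : (x : ℝ) ≤ z.1 := by linarith
        simp only [hx, hx2, not_lt.2 hx', and_false, false_and, false_or, true_and]
    have hmeas : MeasurableSet {z : ℝ × ℝ | ((x : ℝ) ≤ z.1 ∧ z.1 < x + e.1) ∧ 0 ≤ z.2 ∧
          (e.2 : ℝ) * (z.1 - x) + e.1 * (z.2 - (e.2 + chainHeight l)) < 0} := by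
      measurability
    rw [hsplit, MeasureTheory.measure_union' ?_ hmeas, ih h.tail,
      volume_strip _ _ _ _ h1 (by positivity) (by positivity), area_cons,
      ← ENNReal.ofReal_add (by positivity) (by have := area_nonneg l; positivity)]
    · congr 1; ring
    · refine Set.disjoint_left.2 fun z hz hz' => ?_
      have h2 := hz.1.2
      have h3 := hz'.1
      push_cast at h3
      linarith

lemma le_fst_of_aboveChain {l : List (ℕ × ℕ)} (h : IsConvexChain l) (hl : l ≠ []) {x : ℕ} {s : ℝ}
    (hz : AboveChain l x (s, 0)) : (x + chainWidth l : ℕ) ≤ s := by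
  induction l generalizing x with
  | nil => exact absurd rfl hl
  | cons e l ih =>
    by_cases hl' : l = []
    · subst hl'
      have h2 : (0 : ℝ) < e.2 := by exact_mod_cast (h.pos e (by simp)).2
      have hz1 : 0 ≤ (e.2 : ℝ) * (s - x) + e.1 * (0 - chainHeight [e]) := hz.1
      simp only [chainHeight_cons, chainHeight_nil, add_zero, zero_sub, mul_neg] at hz1
      simp only [chainWidth_cons, chainWidth_nil, add_zero]
      push_cast
      refine le_of_mul_le_mul_left ?_ h2
      linear_combination hz1
    · have := ih h.tail hl' hz.2
      rwa [chainWidth_cons, ← add_assoc]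

lemma newtonNumber_eq_of_chain {l : List (ℕ × ℕ)} (h : IsConvexChain l) (hl : l ≠ [])
    {X : Set (ℝ × ℝ)} (hX : newtonPolyhedron X = chainRegion l) :
    newtonNumber X = ((chainWidth l : ℝ) - 1) * (chainHeight l - 1) - deficit l := by
  have hx : xIntercept X = chainWidth l := by
    refine IsLeast.csInf_eq ⟨?_, fun s hs => ?_⟩
    · have := latticePoints_subset_chainRegion h ⟨_, end_mem_chainVertices l 0, rfl⟩
      simpa [hX] using this
    · have hs' : (s, (0 : ℝ)) ∈ newtonPolyhedron X := hs
      rw [hX] at hs'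
      simpa using le_fst_of_aboveChain h hl hs'.2
  have hy : yIntercept X = chainHeight l := by
    refine IsLeast.csInf_eq ⟨?_, fun s hs => ?_⟩
    · have := latticePoints_subset_chainRegion h ⟨_, start_mem_chainVertices l 0, rfl⟩
      simpa [hX] using this
    · have hs' : ((0 : ℝ), s) ∈ newtonPolyhedron X := hs
      rw [hX] at hs'
      obtain ⟨e, l, rfl⟩ := List.exists_cons_of_ne_nil hl
      have h1 : (0 : ℝ) < e.1 := by exact_mod_cast (h.pos e (by simp)).1
      have h2 := hs'.2.1
      simp only [Nat.cast_zero, sub_zero, mul_zero, zero_add] at h2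
      exact sub_nonneg.1 (nonneg_of_mul_nonneg_right h2 h1)
  have ha : 2 * areaBelow X = chainWidth l * chainHeight l - deficit l := by
    have hset : Set.Ici (0 : ℝ × ℝ) \ newtonPolyhedron X =
        {z : ℝ × ℝ | (0 : ℕ) ≤ z.1 ∧ 0 ≤ z.2 ∧ ¬ AboveChain l 0 z} := by
      rw [hX]
      ext z
      have : z ∈ Set.Ici (0 : ℝ × ℝ) ↔ 0 ≤ z.1 ∧ 0 ≤ z.2 := Iff.rfl
      simp only [Set.mem_sdiff, this, chainRegion, Set.mem_ofPred_eq, Nat.cast_zero]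
      tauto
    rw [areaBelow, hset, volume_below_chain h, ENNReal.toReal_ofReal
      (by have := area_nonneg l; positivity)]
    ring
  rw [newtonNumber, ha, hx, hy]
  ring

lemma newtonNumber_tr {p q : ℕ} (hp : 0 < p) (hq : 0 < q) :
    newtonNumber (tr p q) = ((p : ℝ) - 1) * (q - 1) := by
  have h : IsConvexChain [(p, q)] := ⟨by simp [hp, hq], by simp⟩
  have := newtonNumber_eq_of_chain h (by simp) (newtonPolyhedron_eq_chainRegion h (B := tr p q)
    ?_ (tr_subset_chainRegion h (by simp) (by simp)))
  · simpa [deficit] using this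
  · rintro _ ⟨w, hw, rfl⟩
    rcases hw with rfl | hw
    · simpa [tr] using left_mem_segment ℝ ((0 : ℝ), (q : ℝ)) ((p : ℝ), (0 : ℝ))
    · obtain rfl : w = (0 + p, 0) := hw
      simpa [tr] using right_mem_segment ℝ ((0 : ℝ), (q : ℝ)) ((p : ℝ), (0 : ℝ))

/-- A convex lattice chain below the segment is the diagram of a deformation. -/
lemma isAttained_of_chain {l : List (ℕ × ℕ)} (h : IsConvexChain l) (hl : l ≠ []) {p q n : ℕ}
    (hp : chainWidth l ≤ p) (hq : chainHeight l ≤ q)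
    (hn : (n : ℤ) = ((chainWidth l : ℤ) - 1) * (chainHeight l - 1) - deficit l) :
    IsAttained (tr p q) n := by
  refine ⟨_, ⟨chainVertices l 0, fun h0 => ?_, rfl⟩, ?_⟩
  · -- If the origin were a vertex, the first vertex, on the vertical axis, would equal it.
    obtain ⟨e, l, rfl⟩ := List.exists_cons_of_ne_nil hl
    have he := h.pos e (by simp)
    rcases h0 with h0 | h0
    · simp only [Prod.mk.injEq, chainHeight_cons] at h0
      lia
    · have := le_fst_of_mem_chainVertices h0
      lia
  · rw [newtonNumber_eq_of_chain h hl (newtonPolyhedron_newtonDiagram h hl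
      (newtonPolyhedron_eq_chainRegion h Set.subset_union_right
        (Set.union_subset (tr_subset_chainRegion h hp hq) (latticePoints_subset_chainRegion h))))]
    exact_mod_cast hn.symm

/-! ### Deficits for given end-points -/

/-- Some convex chain of lattice edges from `(0, b)` to `(a, 0)` has deficit `d`. -/
def IsDeficit (a b : ℕ) (d : ℤ) : Prop :=
  ∃ l, IsConvexChain l ∧ chainWidth l = a ∧ chainHeight l = b ∧ deficit l = d

lemma isDeficit_zero {a b : ℕ} (ha : 0 < a) (hb : 0 < b) : IsDeficit a b 0 :=
  ⟨[(a, b)], ⟨by simp [ha, hb], by simp⟩, by simp, by simp, by simp [deficit]⟩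

/-- The chain with two edges and one interior vertex `(x, y)`. -/
lemma isDeficit_of_point {a b x y : ℕ} {d : ℤ} (hx : 0 < x) (hxa : x < a) (hy : 0 < y)
    (hyb : y < b) (hd : 0 ≤ d) (h : (a : ℤ) * b = d + b * x + a * y) : IsDeficit a b d := by
  obtain ⟨u, rfl⟩ := Nat.exists_eq_add_of_lt hxa
  obtain ⟨v, rfl⟩ := Nat.exists_eq_add_of_lt hyb
  push_cast at h
  have hdet : ((v : ℤ) + 1) * (u + 1) - x * y = d := by linear_combination h
  refine ⟨[(x, v + 1), (u + 1, y)], ⟨?_, ?_⟩, ?_, ?_, ?_⟩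
  · simp [hx, hy]
  · simp only [List.pairwise_cons, List.mem_singleton, forall_eq, List.not_mem_nil,
      IsEmpty.forall_iff, implies_true, List.Pairwise.nil, and_self, and_true]
    zify
    linarith
  · simp; ring
  · simp; ring
  · simp [deficit]; linarith

lemma chainWidth_append (l m : List (ℕ × ℕ)) :
    chainWidth (l ++ m) = chainWidth l + chainWidth m := by simp [chainWidth]

lemma chainHeight_append (l m : List (ℕ × ℕ)) :
    chainHeight (l ++ m) = chainHeight l + chainHeight m := by simp [chainHeight]

lemma deficit_append (l m : List (ℕ × ℕ)) : deficit (l ++ m) =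
    deficit l + deficit m + chainHeight l * chainWidth m - chainWidth l * chainHeight m := by
  induction l with
  | nil => simp [deficit]
  | cons e l ih =>
    simp only [List.cons_append, deficit, ih, chainWidth_append, chainHeight_append,
      chainWidth_cons, chainHeight_cons]
    push_cast
    ring

/-- Reflection in the diagonal. -/
lemma IsDeficit.swap {a b : ℕ} {d : ℤ} (h : IsDeficit a b d) : IsDeficit b a d := by
  obtain ⟨l, hl, rfl, rfl, rfl⟩ := h
  have key : ∀ l : List (ℕ × ℕ), chainWidth (l.map Prod.swap).reverse = chainHeight l ∧
      chainHeight (l.map Prod.swap).reverse = chainWidth l ∧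
      deficit (l.map Prod.swap).reverse = deficit l := by
    intro l
    induction l with
    | nil => simp [deficit]
    | cons e l ih =>
      obtain ⟨h1, h2, h3⟩ := ih
      simp only [List.map_cons, List.reverse_cons, chainWidth_append, chainHeight_append,
        deficit_append, h1, h2, h3]
      simp only [deficit, chainWidth_cons, chainHeight_cons, chainWidth_nil, chainHeight_nil,
        Prod.fst_swap, Prod.snd_swap]
      push_cast
      refine ⟨by ring, by ring, by ring⟩
  obtain ⟨h1, h2, h3⟩ := key l
  refine ⟨_, ⟨fun e he => ?_, ?_⟩, h1, h2, h3⟩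
  · rw [List.mem_reverse, List.mem_map] at he
    obtain ⟨f, hf, rfl⟩ := he
    exact (hl.pos f hf).symm
  · rw [List.pairwise_reverse, List.pairwise_map]
    exact hl.steep.imp fun {e f} hef => by simpa [mul_comm] using hef

/-- Adding the same slope `k` to all edges preserves determinants; an edge of slope `k` and width
`c` may then follow, and adds `c` times the old height to the deficit. -/
lemma IsDeficit.shear_append {w r k c : ℕ} {d : ℤ} (h : IsDeficit w r d) (hk : 0 < k) :
    IsDeficit (w + c) (k * (w + c) + r) (r * c + d) := by
  obtain ⟨l, hl, rfl, rfl, rfl⟩ := h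
  obtain ⟨f, hf⟩ : ∃ f : ℕ × ℕ → ℕ × ℕ, ∀ e, f e = (e.1, e.2 + k * e.1) := ⟨_, fun _ => rfl⟩
  have key : ∀ l : List (ℕ × ℕ), chainWidth (l.map f) = chainWidth l ∧
      chainHeight (l.map f) = chainHeight l + k * chainWidth l ∧
      deficit (l.map f) = deficit l := by
    intro l
    induction l with
    | nil => simp
    | cons e l ih =>
      obtain ⟨h1, h2, h3⟩ := ih
      simp only [List.map_cons, chainWidth_cons, chainHeight_cons, deficit, h1, h2, h3, hf]
      push_cast
      refine ⟨trivial, by ring, by ring⟩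
  obtain ⟨h1, h2, h3⟩ := key l
  have hpos : ∀ e ∈ l.map f, 0 < e.1 ∧ 0 < e.2 := by
    intro e he
    obtain ⟨e', he', rfl⟩ := List.mem_map.1 he
    have := hl.pos e' he'
    rw [hf]
    exact ⟨this.1, Nat.add_pos_left this.2 _⟩
  have hsteep : (l.map f).Pairwise fun e e' => e'.2 * e.1 ≤ e.2 * e'.1 := by
    rw [List.pairwise_map]
    exact hl.steep.imp fun {e e'} hef => by simp only [hf]; linarith
  rcases Nat.eq_zero_or_pos c with rfl | hc
  · exact ⟨l.map f, ⟨hpos, hsteep⟩, by simp [h1], by simp [h2]; ring, by simp [h3]⟩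
  refine ⟨l.map f ++ [(c, k * c)], ⟨?_, ?_⟩, ?_, ?_, ?_⟩
  · intro e he
    rcases List.mem_append.1 he with he | he
    · exact hpos e he
    · obtain rfl := List.mem_singleton.1 he
      exact ⟨hc, Nat.mul_pos hk hc⟩
  · refine List.pairwise_append.2 ⟨hsteep, by simp, ?_⟩
    intro e he e' he'
    obtain ⟨e, -, rfl⟩ := List.mem_map.1 he
    obtain rfl := List.mem_singleton.1 he'
    simp only [hf]
    nlinarith [Nat.zero_le (e.2 * c)]
  · simp [chainWidth_append, h1]
  · simp only [chainHeight_append, h2, chainHeight_cons, chainHeight_nil]; ring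
  · simp only [deficit_append, h1, h2, h3, deficit, chainWidth_cons, chainHeight_cons,
      chainWidth_nil, chainHeight_nil]
    push_cast
    ring

/-- The interior vertex is `(p - i, k i - 1)`. For `k i = 1` it would lie on the horizontal axis. -/
lemma isDeficit_mul_add_one {p k i : ℕ} (hi : 0 < i) (hip : i < p) (hk : 2 ≤ k * i) :
    IsDeficit p (k * p + 1) (p + i) := by
  have hki : k * i ≤ k * p := Nat.mul_le_mul_left k hip.le
  refine isDeficit_of_point (x := p - i) (y := k * i - 1) (by lia) (by lia) (by lia) (by lia)
    (by positivity) ?_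
  rw [Nat.cast_sub hip.le, Nat.cast_sub (by lia)]
  push_cast
  ring

lemma isDeficit_mul_sub_one {p k : ℕ} (hp : 4 ≤ p) :
    IsDeficit p (k * p + (p - 1)) (p + 1) := by
  obtain ⟨s, rfl⟩ := Nat.exists_eq_add_of_le hp
  refine isDeficit_of_point (x := 1) (y := k * (3 + s) + s + 1) (by lia) (by lia) (by lia)
    ?_ (by positivity) ?_
  · rw [show 4 + s - 1 = 3 + s by lia]; nlinarith
  · rw [show 4 + s - 1 = 3 + s by lia]
    push_cast
    ring

/-- Below the segment from `(0, q)` to `(p, 0)`, where `p = r + t` and `q = k p + r`, all areas from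
`gcd(p, q)` to `r t` are available. After shearing, the chain may begin with any chain of width
`p - c` and height `r`, which contributes `r c` plus a deficit of a smaller triangle. -/
theorem isDeficit_of_le {r t k d : ℕ} (hr : 0 < r) (ht : 0 < t) (hk : 0 < k)
    (h1 : Nat.gcd r t ≤ d) (h2 : d ≤ r * t) : IsDeficit (r + t) (k * (r + t) + r) d := by
  induction hp : r + t using Nat.strong_induction_on generalizing r t k d with
  | _ p ih =>
  subst hp
  have step : ∀ c w d' : ℕ, w + c = r + t → d = r * c + d' → IsDeficit r w d' →
      IsDeficit (r + t) (k * (r + t) + r) d := by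
    intro c w d' hw hd h
    rw [← hw, hd]
    push_cast
    exact h.swap.shear_append hk
  obtain ⟨c, e, hd, her⟩ : ∃ c e, d = r * c + e ∧ e < r :=
    ⟨d / r, d % r, (Nat.div_add_mod d r).symm, Nat.mod_lt d hr⟩
  have hct : c ≤ t := le_of_mul_le_mul_left (by lia : r * c ≤ r * t) hr
  rcases Nat.eq_zero_or_pos e with rfl | he
  · exact step c (r + t - c) 0 (by lia) hd (isDeficit_zero hr (by lia))
  have hct' : c < t := hct.lt_of_ne (by rintro rfl; lia)
  obtain ⟨w, hw⟩ : ∃ w, w + c = r + t := ⟨r + t - c, by lia⟩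
  -- If `c = 0`, then `e = d` is at least the greatest common divisor of `r` and `w = r + t`.
  have hc : e < Nat.gcd r w → ∃ c', c = c' + 1 := by
    intro hlt
    refine Nat.exists_eq_add_one.2 (Nat.pos_of_ne_zero ?_)
    rintro rfl
    obtain rfl : w = r + t := by simpa using hw
    rw [Nat.gcd_self_add_right] at hlt
    lia
  have hdecomp := Nat.div_add_mod w r
  set κ := w / r with hκ
  set ρ := w % r with hρ
  have hκ0 : 0 < κ := Nat.div_pos (by lia) hr
  have hρr : ρ < r := Nat.mod_lt w hr
  rcases Nat.eq_zero_or_pos ρ with hρ0 | hρ0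
  · -- All deficits of chains of width `w = κ r` and height `r` are multiples of `r`, so
    -- one unit of `c` is given back: width `w + 1` and deficit `r + e` replace width `w` and
    -- deficit `e`.
    rw [hρ0, add_zero] at hdecomp
    have hgcd : Nat.gcd r w = r := Nat.gcd_eq_left ⟨κ, hdecomp.symm⟩
    obtain ⟨c', rfl⟩ := hc (by lia)
    have hκ2 : 2 ≤ κ := by
      by_contra hlt
      obtain h1 : κ = 1 := by lia
      rw [h1] at hdecomp
      lia
    refine step c' (w + 1) (r + e) (by lia) (by rw [hd]; ring) ?_
    rw [← hdecomp, mul_comm r κ]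
    push_cast
    exact isDeficit_mul_add_one he her (by nlinarith)
  obtain ⟨τ, hτ⟩ : ∃ τ, r = ρ + τ := ⟨r - ρ, by lia⟩
  have hτ0 : 0 < τ := by lia
  have hgcd : Nat.gcd ρ τ = Nat.gcd r w := by
    have h3 : Nat.gcd r w = Nat.gcd ρ r := Nat.gcd_rec r w
    rw [h3, hτ]; simp
  have hwκ : κ * (ρ + τ) + ρ = w := by rw [← hτ, mul_comm]; exact hdecomp
  rcases le_or_gt (Nat.gcd r w) e with hge | hlt
  · refine step c w e hw hd ?_
    have := ih (ρ + τ) (by lia) (r := ρ) (t := τ) (k := κ) (d := e) hρ0 hτ0 hκ0 (by lia)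
      (by nlinarith) rfl
    rwa [hwκ, ← hτ] at this
  · -- The target `e` is below the least positive deficit for width `w`, so again one unit of `c` is
    -- given back.
    obtain ⟨c', rfl⟩ := hc hlt
    have hg1 : Nat.gcd ρ τ ∣ ρ := Nat.gcd_dvd_left _ _
    have hg2 : Nat.gcd ρ τ ∣ τ := Nat.gcd_dvd_right _ _
    rw [← hgcd] at hlt
    have hg1' := Nat.le_of_dvd hρ0 hg1
    have hg2' := Nat.le_of_dvd hτ0 hg2
    refine step c' (w + 1) (r + e) (by lia) (by rw [hd]; ring) ?_
    rcases le_or_gt 3 τ with hτ3 | hτ3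
    · obtain ⟨σ, rfl⟩ : ∃ σ, τ = σ + 1 := ⟨τ - 1, by lia⟩
      have hle : Nat.gcd (ρ + 1) σ ≤ ρ + 1 := Nat.le_of_dvd (by lia) (Nat.gcd_dvd_left _ _)
      have := ih (ρ + 1 + σ) (by lia) (r := ρ + 1) (t := σ) (k := κ) (d := r + e) (by lia)
        (by lia) hκ0 (by lia) (by nlinarith) rfl
      rw [show ρ + 1 + σ = r by lia, show κ * r + (ρ + 1) = w + 1 by rw [← hwκ, hτ]; ring] at this
      exact_mod_cast this
    · obtain rfl : τ = 2 := by lia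
      obtain rfl : e = 1 := by lia
      have := isDeficit_mul_sub_one (p := r) (k := κ) (by lia)
      rw [show κ * r + (r - 1) = w + 1 by rw [← hwκ, ← hτ]; lia] at this
      exact_mod_cast this

/-! ### Newton numbers of chains -/

/-- The integer `n` is the Newton number of a convex lattice chain from `(0, b)` to `(a, 0)`
with `a ≤ p` and `b ≤ q`. -/
def IsChainNumber (p q : ℕ) (n : ℤ) : Prop :=
  ∃ a b : ℕ, ∃ d : ℤ, (0 < a ∧ a ≤ p) ∧ (0 < b ∧ b ≤ q) ∧ IsDeficit a b d ∧
    n = ((a : ℤ) - 1) * (b - 1) - d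

lemma IsChainNumber.mono {p q p' q' : ℕ} {n : ℤ} (h : IsChainNumber p q n) (hp : p ≤ p')
    (hq : q ≤ q') : IsChainNumber p' q' n := by
  obtain ⟨a, b, d, ha, hb, h⟩ := h
  exact ⟨a, b, d, ⟨ha.1, ha.2.trans hp⟩, ⟨hb.1, hb.2.trans hq⟩, h⟩

lemma IsChainNumber.isAttained {p q n : ℕ} (h : IsChainNumber p q n) : IsAttained (tr p q) n := by
  obtain ⟨a, b, d, ha, hb, ⟨l, hl, rfl, rfl, rfl⟩, hn⟩ := h
  refine isAttained_of_chain hl ?_ ha.2 hb.2 hn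
  rintro rfl
  simp at ha

/-- The numbers just below the Newton number of `tr(p, K p)` come from chains with end-points
`(p, 0)` and `(0, b)`, where `b` is `K p + 1` as a rule, `(K + 1) p - 1` for `j = 1`, and, for
`j = 2` and `K = 1`, `2 p - 1` or, if `p = 5`, `8`. -/
lemma isChainNumber_sub {p q K j : ℕ} (hp : 5 ≤ p) (hK : 0 < K) (hq : (K + 1) * p ≤ q + 1)
    (hpq : p + 3 ≤ q) (hj : 0 < j) (hjp : j + 2 ≤ p) :
    IsChainNumber p q (((p : ℤ) - 1) * (K * p - 1) - j) := by
  obtain ⟨s, rfl⟩ := Nat.exists_eq_add_of_le hp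
  rcases (by lia : j = 1 ∨ (j = 2 ∧ K = 1) ∨ (2 ≤ j ∧ (3 ≤ j ∨ 2 ≤ K))) with rfl | ⟨rfl, rfl⟩ | hj'
  · refine ⟨5 + s, K * (5 + s) + 4 + s, (4 + s) ^ 2 + 1, by lia, ⟨by lia, by linarith⟩, ?_, ?_⟩
    · obtain ⟨L, rfl⟩ := Nat.exists_eq_add_of_lt hK
      refine isDeficit_of_point (x := 2) (y := L * (3 + s) + s + 2) (by lia) (by lia) (by lia)
        (by nlinarith) (by positivity) ?_
      push_cast; ring
    · push_cast; ring
  · rcases Nat.eq_zero_or_pos s with rfl | hs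
    · exact ⟨5, 8, 14, by lia, by lia, isDeficit_of_point (x := 2) (y := 2) (by lia) (by lia)
        (by lia) (by lia) (by lia) (by norm_num), by norm_num⟩
    · refine ⟨5 + s, 9 + 2 * s, (4 + s) ^ 2 + 2, by lia, by lia, ?_, ?_⟩
      · refine isDeficit_of_point (x := 3) (y := s) (by lia) (by lia) hs (by lia)
          (by positivity) ?_
        push_cast; ring
      · push_cast; ring
  · obtain ⟨i, rfl⟩ : ∃ i, j = i + 1 := ⟨j - 1, by lia⟩
    refine ⟨5 + s, K * (5 + s) + 1, (5 + s : ℕ) + i, by lia, ⟨by lia, by linarith⟩,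
      isDeficit_mul_add_one (by lia) (by lia) ?_, ?_⟩
    · rcases hj'.2 with h | h <;> nlinarith
    · push_cast; ring

/-- The deficit of the number that the third exception for `tr(p, K p - 1)` leaves out, measured
from `tr(p, K p + 1)`; the interior vertex is `(2, K (p - 2) - 2)`. -/
lemma isDeficit_three_mul_sub_two {p K : ℕ} (hp : 5 ≤ p) (hK : 0 < K) :
    IsDeficit p (K * p + 1) (3 * p - 2) := by
  obtain ⟨s, rfl⟩ := Nat.exists_eq_add_of_le hp
  obtain ⟨L, rfl⟩ := Nat.exists_eq_add_of_lt hK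
  refine isDeficit_of_point (x := 2) (y := L * (3 + s) + s + 1) (by lia) (by lia) (by lia)
    (by nlinarith) (by push_cast; linarith) ?_
  push_cast; ring

/-- The numbers just below the Newton number of `tr(p, p)` come from `tr(p, p + 1)` and
`tr(p + 1, p + 2)`. -/
lemma isChainNumber_sub_of_succ {p j : ℕ} (hp : 5 ≤ p) (hj : 0 < j) (hjp : j + 2 ≤ p) :
    IsChainNumber (p + 1) (p + 2) (((p : ℤ) - 1) * (p - 1) - j) := by
  rcases (by lia : j = 1 ∨ j = 2 ∨ 3 ≤ j) with rfl | rfl | hj'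
  · obtain ⟨s, rfl⟩ := Nat.exists_eq_add_of_le hp
    refine ⟨6 + s, 7 + s, 15 + 3 * s, by lia, by lia, ?_, ?_⟩
    · refine isDeficit_of_point (x := 3) (y := s + 1) (by lia) (by lia) (by lia) (by lia)
        (by positivity) ?_
      push_cast; ring
    · push_cast; ring
  · refine ⟨p + 1, 1 * (p + 1) + 1, _, by lia, by lia,
      isDeficit_three_mul_sub_two (by lia) one_pos, ?_⟩
    push_cast; ring
  · obtain ⟨i, rfl⟩ : ∃ i, j = i + 1 := ⟨j - 1, by lia⟩
    refine ⟨p, 1 * p + 1, p + i, by lia, by lia,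
      isDeficit_mul_add_one (by lia) (by lia) (by lia), ?_⟩
    push_cast; ring

/-- The descent in `p` ends here: the numbers up to `12`, the Newton number of `tr(4, 5)`, are
exhibited directly. -/
lemma isChainNumber_five_six {n : ℕ} (hn : n ≤ 12) : IsChainNumber 5 6 n := by
  have full : ∀ a b : ℕ, 0 < a → a ≤ 5 → 0 < b → b ≤ 6 →
      (n : ℤ) = ((a : ℤ) - 1) * (b - 1) → IsChainNumber 5 6 n := fun a b ha ha' hb hb' h =>
    ⟨a, b, 0, ⟨ha, ha'⟩, ⟨hb, hb'⟩, isDeficit_zero ha hb, by rw [h]; ring⟩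
  rcases (by lia : n ≤ 5 ∨ n = 6 ∨ n = 7 ∨ n = 8 ∨ n = 9 ∨ n = 10 ∨ n = 11 ∨ n = 12) with
    h | rfl | rfl | rfl | rfl | rfl | rfl | rfl
  · exact full 2 (n + 1) (by lia) (by lia) (by lia) (by lia) (by push_cast; ring)
  · exact full 3 4 (by lia) (by lia) (by lia) (by lia) (by norm_num)
  · exact ⟨3, 6, 3, by lia, by lia, isDeficit_of_point (x := 2) (y := 1) (by lia) (by lia)
      (by lia) (by lia) (by lia) (by norm_num), by norm_num⟩
  · exact full 3 5 (by lia) (by lia) (by lia) (by lia) (by norm_num)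
  · exact full 4 4 (by lia) (by lia) (by lia) (by lia) (by norm_num)
  · exact full 3 6 (by lia) (by lia) (by lia) (by lia) (by norm_num)
  · exact ⟨4, 5, 1, by lia, by lia, isDeficit_of_point (x := 3) (y := 1) (by lia) (by lia)
      (by lia) (by lia) (by lia) (by norm_num), by norm_num⟩
  · exact full 4 5 (by lia) (by lia) (by lia) (by lia) (by norm_num)

/-- The statement for chains. The induction passes from `tr(p, q)` to `tr(p, q - 1)` for `r ≥ 2`,
and across a multiple of `p` to `tr(p, k p - 1)`, or to `tr(p - 1, p)` if `k = 1`, for `r = 1`. -/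
theorem isChainNumber_or_exceptional {p k r n : ℕ} (hp : 5 ≤ p) (hk : 0 < k) (hr : 0 < r)
    (hrp : r < p) (hn : (n : ℤ) ≤ ((p : ℤ) - 1) * (k * p + r - 1)) :
    IsChainNumber p (k * p + r) n ∨
    (((p : ℤ) - 1) * (k * p + r - 1) - Nat.gcd p r < n ∧
      (n : ℤ) < ((p : ℤ) - 1) * (k * p + r - 1)) ∨
    (((p : ℤ) - 1) * (k * p - 1) - (p - 1) < n ∧ (n : ℤ) < ((p : ℤ) - 1) * (k * p - 1)) ∨
    (Even p ∧ r = p - 1 ∧ (n : ℤ) = ((p : ℤ) - 1) * (k * p + r - 1) - p) := by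
  induction hN : p + (k * p + r) using Nat.strong_induction_on generalizing p k r with
  | _ N ih =>
  subst hN
  obtain ⟨d, hd⟩ : ∃ d : ℕ, (n : ℤ) = ((p : ℤ) - 1) * (k * p + r - 1) - d :=
    ⟨(((p : ℤ) - 1) * (k * p + r - 1) - n).toNat, by lia⟩
  have of_deficit : IsDeficit p (k * p + r) d → IsChainNumber p (k * p + r) n := fun h =>
    ⟨p, k * p + r, d, by lia, by lia, h, by rw [hd]; push_cast; ring⟩
  rcases Nat.eq_zero_or_pos d with rfl | hd0
  · exact Or.inl (of_deficit (isDeficit_zero (by lia) (by lia)))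
  rcases lt_or_ge d (Nat.gcd p r) with hdg | hdg
  · exact Or.inr (Or.inl (by lia))
  obtain ⟨t, rfl⟩ : ∃ t, p = r + t := ⟨p - r, by lia⟩
  have ht : 0 < t := by lia
  rcases le_or_gt d (r * t) with hdrt | hdrt
  · refine Or.inl (of_deficit (isDeficit_of_le hr ht hk ?_ hdrt))
    rwa [Nat.gcd_comm, Nat.gcd_self_add_right] at hdg
  rcases (by lia : 2 ≤ r ∨ r = 1) with hr2 | rfl
  · -- Here `d ≥ p - 1`, so `n` is at most the Newton number of `tr(p, q - 1)`.
    obtain ⟨s, rfl⟩ : ∃ s, r = s + 1 := ⟨r - 1, by lia⟩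
    have hIH := ih (s + 1 + t + (k * (s + 1 + t) + s)) (by lia) (p := s + 1 + t) (k := k) (r := s)
      hp hk (by lia) (by lia) (by rw [hd]; push_cast; nlinarith) rfl
    rcases hIH with h | h | h | h
    · exact Or.inl (h.mono le_rfl (by lia))
    · have hg : Nat.gcd (s + 1 + t) s = Nat.gcd s (t + 1) := by
        rw [Nat.gcd_comm, show s + 1 + t = s + (t + 1) by ring, Nat.gcd_self_add_right]
      have hgs : Nat.gcd s (t + 1) ≤ s := Nat.le_of_dvd (by lia) (Nat.gcd_dvd_left _ _)
      have hdg' : d < s + t + Nat.gcd s (t + 1) := by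
        have h1 := h.1
        rw [hg, hd] at h1
        zify
        push_cast at h1
        linarith
      rcases (by lia : t = 1 ∨ 2 ≤ t) with rfl | ht2
      · -- The previous residue is `p - 2`, which has a factor in common with `p` for even `p` only.
        have hg2 : Nat.gcd s (1 + 1) ∣ 2 := Nat.gcd_dvd_right _ _
        have hgd : Nat.gcd s (1 + 1) ∣ s := Nat.gcd_dvd_left _ _
        have hle := Nat.le_of_dvd two_pos hg2
        have he : Nat.gcd s (1 + 1) = 2 := by lia
        rw [he] at hgd
        refine Or.inr (Or.inr (Or.inr ⟨?_, by lia, ?_⟩))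
        · rw [Nat.even_iff]; lia
        · rw [hd]; congr 1; lia
      · nlinarith
    · exact Or.inr (Or.inr (Or.inl h))
    · lia
  · -- Here `d ≥ p`; beyond the second gap, `n` is at most the Newton number of `tr(p, k p - 1)`.
    rw [one_mul] at hdrt
    rcases lt_or_ge d (2 * t) with hd2 | hd2
    · refine Or.inr (Or.inr (Or.inl ?_))
      rw [hd]
      push_cast
      constructor <;> nlinarith
    left
    rcases (by lia : k = 1 ∨ 2 ≤ k) with rfl | hk2
    · rcases (by lia : t = 4 ∨ 5 ≤ t) with rfl | ht5
      · exact isChainNumber_five_six (by norm_num at hd; lia)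
      · have hIH := ih (t + (1 * t + 1)) (by lia) (p := t) (k := 1) (r := 1) ht5 one_pos one_pos
          (by lia) (by rw [hd]; push_cast; nlinarith) rfl
        rcases hIH with h | h | h | h
        · exact h.mono (by lia) (by lia)
        · rw [Nat.gcd_one_right] at h
          lia
        · obtain ⟨j, hj⟩ : ∃ j : ℕ, (n : ℤ) = ((t : ℤ) - 1) * (t - 1) - j :=
            ⟨(((t : ℤ) - 1) * (t - 1) - n).toNat, by push_cast at h; lia⟩
          rw [hj] at h ⊢
          push_cast at h
          exact (isChainNumber_sub_of_succ ht5 (by lia) (by lia)).mono (by lia) (by lia)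
        · lia
    · obtain ⟨K, rfl⟩ : ∃ K, k = K + 1 := ⟨k - 1, by lia⟩
      have hq : K * (1 + t) + t ≤ (K + 1) * (1 + t) + 1 := by rw [add_mul]; lia
      have hIH := ih (1 + t + (K * (1 + t) + t)) (by rw [add_mul K]; lia) (p := 1 + t) (k := K)
        (r := t) hp (by lia) (by lia) (by lia) (by rw [hd]; push_cast; nlinarith) rfl
      rcases hIH with h | h | h | h
      · exact h.mono le_rfl hq
      · rw [Nat.gcd_add_self_left, Nat.gcd_one_left] at h
        lia
      · obtain ⟨j, hj⟩ : ∃ j : ℕ,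
            (n : ℤ) = (((1 + t : ℕ) : ℤ) - 1) * (K * (1 + t : ℕ) - 1) - j :=
          ⟨((((1 + t : ℕ) : ℤ) - 1) * (K * (1 + t : ℕ) - 1) - n).toNat, by lia⟩
        rw [hj] at h ⊢
        exact isChainNumber_sub hp (by lia) (by lia) (by nlinarith) (by lia) (by lia)
      · refine of_deficit ?_
        convert isDeficit_three_mul_sub_two hp (K := K + 1) (by lia) using 1
        have := h.2.2
        rw [hd] at this
        push_cast at this ⊢
        linear_combination -this

theorem mainTheorem3 (p q k r : ℕ) (hp : 4 < p) (hpq : p < q)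
    (hq : q = k * p + r) (hr : 0 < r) (hrp : r < p)
    (n : ℕ) (hn : 1 ≤ n) (hnu : (n : ℝ) ≤ newtonNumber (tr p q)) :
    IsAttained (tr p q) n ∨
    (newtonNumber (tr p q) - (Nat.gcd p q : ℝ) < n ∧ (n : ℝ) < newtonNumber (tr p q)) ∨
    (newtonNumber (tr p (k * p)) - ((p : ℝ) - 1) < n ∧
      (n : ℝ) < newtonNumber (tr p (k * p))) ∨
    (Even p ∧ r = p - 1 ∧ (n : ℝ) = newtonNumber (tr p q) - p) ∨
    (Even p ∧ (n : ℝ) = newtonNumber (tr p (k * p)) - (2 * (p : ℝ) - 1)) := by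
  have hk : 0 < k := by
    refine Nat.pos_of_ne_zero ?_
    rintro rfl
    lia
  subst hq
  have hg : Nat.gcd p (k * p + r) = Nat.gcd p r := by simp
  rw [newtonNumber_tr (by lia) (by lia)] at hnu ⊢
  rw [newtonNumber_tr (by lia) (by positivity), hg]
  push_cast at hnu ⊢
  rcases isChainNumber_or_exceptional (n := n) hp hk hr hrp (by exact_mod_cast hnu) with
    h | h | h | h
  · exact Or.inl h.isAttained
  · exact Or.inr (Or.inl (by exact_mod_cast h))
  · exact Or.inr (Or.inr (Or.inl (by exact_mod_cast h)))
  · exact Or.inr (Or.inr (Or.inr (Or.inl (by exact_mod_cast h))))
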